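/- Consider the Gaussian MISO broadcast channel with $N$ transmit antennas and $K$ single-antenna users, $1\le K\le N$, noise variance $1$, and independent Rayleigh fading: $h_1,\dots,h_K$ are i.i.d. $\mathcal{CN}(0,2I_N)$. Fix a threshold $\theta^{th}\in(0,1)$ and a target rate $R^{th}>0$, and write $\Pi_F$ for the orthogonal projection onto the column space of $F$, and $\Pi_F^\perp=I-\Pi_F$. Grouping. For a vector $b$ and matrices $A,B$ let $\phi(A,b)=\|\Pi_A b\|^2/\|b\|^2$ (and $0$ if $b=0$), let $\theta(A,B)$ be the maximum of all $\phi(A,b_i)$ and $\phi(B,a_j)$ over the columns $b_i$ of $B$ and $a_j$ of $A$, and let $\theta(A,B)=0$ if $A$ or $B$ is empty. Start with the candidate set $\mathcal K=\{1,\dots,K\}$, $f_u=h_u$ and $n_g=1$. While $n_g\le K$: if there is a set $S\subseteq\mathcal K$ with $|S|=n_g$ and $\theta(F_{\mathcal K\setminus S},F_S)\le\theta^{th}$, where $F_S$ has the columns $f_u$, $u\in S$, make one such $S$ the next group, remove $S$ from $\mathcal K$ and replace $f_u$ by $\Pi_{F_S}^\perp f_u$ for the remaining users $u$; otherwise increase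 $n_g$ by one. If candidates are left over when the loop ends, they form one last group. Transmission. For a group $\mathcal G$ with $L$ users and a user $i\in\mathcal G$, the effective channel is $g_i=\Pi_{\tilde H}^\perp h_i$, where $\tilde H$ consists of the channels of all users outside $\mathcal G$. Number the users of $\mathcal G$ so that $\|g_1\|^2\ge\dots\ge\|g_L\|^2$. At total transmit power $P_t$ the group gets power $LP_t/K$, and its $i$-th user the fraction $\delta_i$ of it, where $\delta_1,\dots,\delta_L>0$ are constants, not depending on the channel realization or on $P_t$, with $\sum_i\delta_i=1$ and $\frac{\delta_i}{2^{R^{th}}-1}-\sum_{m<i}\delta_m>0$ for $i=2,\dots,L$; they may be chosen separately for each possible group. All users of $\mathcal G$ use the same beam vector $w$, a solution of $\max_{\|w\|^2\le1}\min_{i\le L}|(g_i/\|g_i\|)^Hw|^2$. With superposition coding and successive interference cancellation, and $p_i=\delta_iLP_t/K$, the rate of the $i$-th user of $\mathcal G$ is $$R_i=\log_2\Bigl(1+\min_{j\le i}\frac{p_i|g_j^Hw|^2}{\sum_{m<i}p_m|g_j^Hw|^2+1}\Bigr).$$ Power fractions and transmissions of this kind exist, and for every choice of them (of the admissible groups in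 the algorithm, of the order of users with equal norms, of the optimal beam vectors, and of the power fractions) the diversity order of the overall system is $$D:=-\lim_{P_t\to\infty}\frac{\log P_{out}(P_t)}{\log P_t}=N,$$ where $P_{out}$ is the overall outage probability, i.e. the probability that at least one of the $K$ users has a rate below $R^{th}$; the same holds if $P_{out}$ is instead the expected fraction of the $K$ users whose rate is below $R^{th}$. This equals the diversity order of single-user maximal-ratio transmit beamforming, for which $P_{out}=\Pr\{\log_2(1+\|h_k\|^2P_t)<R^{th}\}$ also satisfies $-\lim_{P_t\to\infty}\log P_{out}/\log P_t=N$. -/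

import Mathlib

namespace MixtureBC

noncomputable section

/-- Complex `N`-vectors with the 2-norm. -/
abbrev CVec (N : ℕ) : Type := EuclideanSpace ℂ (Fin N)

/-- A channel realization: the channel vectors `h_1, …, h_K` of the `K` users. -/
abbrev Channel (N K : ℕ) : Type := Fin K → CVec N

/-- Real part (`false`) or imaginary part (`true`) of the `n`-th entry of the channel of user `k`. -/
def realCoord {N K : ℕ} {Ω : Type*} (H : Ω → Channel N K) (i : Fin K × Fin N × Bool) (ω : Ω) : ℝ :=
  if i.2.2 then (H ω i.1 i.2.1).im else (H ω i.1 i.2.1).re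

/-- Independent Rayleigh fading: `h_1, …, h_K` are i.i.d. `CN(0, 2 I_N)`, i.e. the real and
imaginary parts of all entries are independent real standard Gaussian variables. -/
structure IsRayleighFading {N K : ℕ} {Ω : Type*} [MeasurableSpace Ω]
    (μ : MeasureTheory.Measure Ω) (H : Ω → Channel N K) : Prop where
  law : ∀ i, ProbabilityTheory.HasLaw (realCoord H i) (ProbabilityTheory.gaussianReal 0 1) μ
  indep : ProbabilityTheory.iIndepFun (realCoord H) μ

/-- Orthogonal projection of `x` onto the column space of the vectors `f u`, `u ∈ S`. -/
def projOnto {N K : ℕ} (f : Channel N K) (S : Finset (Fin K)) (x : CVec N) : CVec N :=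
  (Submodule.span ℂ (f '' (S : Set (Fin K)))).starProjection x

/-- Orthogonal projection of `x` onto the orthogonal complement of the column space of the
vectors `f u`, `u ∈ S`. -/
def projOff {N K : ℕ} (f : Channel N K) (S : Finset (Fin K)) (x : CVec N) : CVec N :=
  (Submodule.span ℂ (f '' (S : Set (Fin K))))ᗮ.starProjection x

/-- The angle metric between the vector `b` and the column space of the `f u`, `u ∈ S`. -/
def phi {N K : ℕ} (f : Channel N K) (S : Finset (Fin K)) (b : CVec N) : ℝ :=
  ‖projOnto f S b‖ ^ 2 / ‖b‖ ^ 2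

/-- The subspace angle metric between the columns indexed by `A` and those indexed by `B`. -/
def theta {N K : ℕ} (f : Channel N K) (A B : Finset (Fin K)) : ℝ :=
  if h : A.Nonempty ∧ B.Nonempty then
    max (B.sup' h.2 fun b => phi f A (f b)) (A.sup' h.1 fun a => phi f B (f a))
  else 0

/-- State of the grouping algorithm: the candidate set, the current (projected) vectors, the
current group size `n_g`, and the groups constructed so far, in order. -/
structure GroupingState (N K : ℕ) where
  cand : Finset (Fin K)
  vec : Channel N K
  size : ℕ
  groups : List (Finset (Fin K))

/-- Initial state of the grouping algorithm. -/
def GroupingState.init {N K : ℕ} (h : Channel N K) : GroupingState N K :=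
  { cand := Finset.univ, vec := h, size := 1, groups := [] }

/-- `S` is an admissible next group in state `s`. -/
def GroupingState.Admissible {N K : ℕ} (θth : ℝ) (s : GroupingState N K)
    (S : Finset (Fin K)) : Prop :=
  S ⊆ s.cand ∧ S.card = s.size ∧ theta s.vec (s.cand \ S) S ≤ θth

/-- One pass through the loop. When several admissible groups exist, any of them may be
selected. (The vectors of users that have left the candidate set are never used again.) -/
inductive GroupingStep {N K : ℕ} (θth : ℝ) : GroupingState N K → GroupingState N K → Prop
  | found (s : GroupingState N K) (S : Finset (Fin K)) (hsize : s.size ≤ K)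
      (hS : s.Admissible θth S) :
      GroupingStep θth s
        { cand := s.cand \ S
          vec := fun u => projOff s.vec S (s.vec u)
          size := s.size
          groups := s.groups ++ [S] }
  | notFound (s : GroupingState N K) (hsize : s.size ≤ K)
      (hS : ∀ S, ¬ s.Admissible θth S) :
      GroupingStep θth s { s with size := s.size + 1 }

/-- `G` is a possible list of groups produced by the grouping algorithm for the channel `h`.
Candidates that are left over when the loop ends (their number being smaller than the
current group size) form one last group. -/
def IsGrouping {N K : ℕ} (θth : ℝ) (h : Channel N K) (G : List (Finset (Fin K))) : Prop :=
  ∃ s : GroupingState N K,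
    Relation.ReflTransGen (GroupingStep θth) (GroupingState.init h) s ∧ K < s.size ∧
      G = s.groups ++ (if s.cand.Nonempty then [s.cand] else [])

/-- The group that contains user `k`. -/
def groupOf {K : ℕ} (G : List (Finset (Fin K))) (k : Fin K) : Finset (Fin K) :=
  Finset.univ.filter fun j => ∃ S ∈ G, k ∈ S ∧ j ∈ S

/-- The projected effective channel of user `k` when the group `S` is protected by inter-group
zero-forcing: the channels of all users outside `S` are projected out. -/
def effChannel {N K : ℕ} (h : Channel N K) (S : Finset (Fin K)) (k : Fin K) : CVec N :=
  projOff h Sᶜ (h k)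

/-- SINR of the message for user `k` at user `j` inside the group `S` with effective channels
`g`, beam vectors `w` and powers `p`, when the messages of the users of larger rank have been
cancelled (noise variance one). -/
def sinr {N K : ℕ} (g : Channel N K) (S : Finset (Fin K)) (rank : Fin K → ℕ)
    (w : Fin K → CVec N) (p : Fin K → ℝ) (j k : Fin K) : ℝ :=
  p k * ‖inner ℂ (g j) (w k)‖ ^ 2 /
    ((∑ m ∈ S with rank m < rank k, p m * ‖inner ℂ (g j) (w m)‖ ^ 2) + 1)

/-- Rate of user `k` in the group `S` under superposition coding and SIC: the message of user
`k` is decoded by `k` and by all users of smaller rank in the group. -/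
def sicRate {N K : ℕ} (g : Channel N K) (S : Finset (Fin K)) (rank : Fin K → ℕ)
    (w : Fin K → CVec N) (p : Fin K → ℝ) (k : Fin K) : ℝ :=
  Real.logb 2 (1 + ⨅ j : {j : Fin K // j ∈ S ∧ rank j ≤ rank k}, sinr g S rank w p j k)

/-- `w` solves the max-min problem for the normalized effective channels of the group `S`. -/
def IsMaxMinBeam {N K : ℕ} (g : Channel N K) (S : Finset (Fin K)) (w : CVec N) : Prop :=
  ‖w‖ ^ 2 ≤ 1 ∧ ∀ v : CVec N, ‖v‖ ^ 2 ≤ 1 →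
    (⨅ i : S, ‖inner ℂ (((‖g i‖⁻¹ : ℝ) : ℂ) • g i) v‖ ^ 2) ≤
      ⨅ i : S, ‖inner ℂ (((‖g i‖⁻¹ : ℝ) : ℂ) • g i) w‖ ^ 2

/-- What the transmitter determines from the channel: the groups, the position (counted from
`0`) of each user in the ordering of its group, and the intra-group beam vectors. -/
structure Transmission (N K : ℕ) where
  groups : List (Finset (Fin K))
  rank : Fin K → ℕ
  beam : Fin K → CVec N

/-- The transmission follows the mixture architecture with the grouping algorithm: in each
group the users are ordered by decreasing effective channel norm and use a common beam vector
that solves the max-min problem. -/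
structure Transmission.IsMixture {N K : ℕ} (θth : ℝ) (h : Channel N K)
    (t : Transmission N K) : Prop where
  grouping : IsGrouping θth h t.groups
  rank_bijOn : ∀ S ∈ t.groups, Set.BijOn t.rank (S : Set (Fin K)) (Set.Iio S.card)
  rank_norm : ∀ S ∈ t.groups, ∀ a ∈ S, ∀ b ∈ S, t.rank a < t.rank b →
    ‖effChannel h S b‖ ^ 2 ≤ ‖effChannel h S a‖ ^ 2
  beam : ∀ S ∈ t.groups, ∃ w, IsMaxMinBeam (effChannel h S) S w ∧ ∀ k ∈ S, t.beam k = w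

/-- In-group power distribution factors suited to the target rate `R`: the user at position `i`
(counted from `0`) of the group `S` gets the fraction `δ S i` of the group power. -/
structure IsPowerDistribution {K : ℕ} (R : ℝ) (δ : Finset (Fin K) → ℕ → ℝ) : Prop where
  pos : ∀ S, ∀ i < S.card, 0 < δ S i
  sum_eq_one : ∀ S : Finset (Fin K), S.Nonempty → ∑ i ∈ Finset.range S.card, δ S i = 1
  gap : ∀ S, ∀ i < S.card, 1 ≤ i →
    0 < δ S i / ((2 : ℝ) ^ R - 1) - ∑ m ∈ Finset.range i, δ S m

/-- Rate of user `k` at total transmit power `P`: the group `S` of the user gets the power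
`|S| P / K`, split according to `δ`. -/
def Transmission.rate {N K : ℕ} (t : Transmission N K) (δ : Finset (Fin K) → ℕ → ℝ)
    (h : Channel N K) (P : ℝ) (k : Fin K) : ℝ :=
  let S := groupOf t.groups k
  sicRate (effChannel h S) S t.rank t.beam
    (fun m => δ S (t.rank m) * ((S.card : ℝ) * (P / K))) k

/-- Overall outage probability at transmit power `P` and target rate `R`: the probability that
at least one user is in outage. -/
def overallOutage {N K : ℕ} {Ω : Type*} [MeasurableSpace Ω] (μ : MeasureTheory.Measure Ω)
    (H : Ω → Channel N K) (T : Channel N K → Transmission N K)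
    (δ : Finset (Fin K) → ℕ → ℝ) (R P : ℝ) : ℝ :=
  μ.real {ω | ∃ k, (T (H ω)).rate δ (H ω) P k < R}

/-- Overall outage frequency: the expected fraction of the `K` users that are in outage. -/
def outageFrequency {N K : ℕ} {Ω : Type*} [MeasurableSpace Ω] (μ : MeasureTheory.Measure Ω)
    (H : Ω → Channel N K) (T : Channel N K → Transmission N K)
    (δ : Finset (Fin K) → ℕ → ℝ) (R P : ℝ) : ℝ :=
  (∑ k, μ.real {ω | (T (H ω)).rate δ (H ω) P k < R}) / K

/-- Outage probability of single-user MRT beamforming over the channel of user `k` alone. -/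
def mrtOutage {N K : ℕ} {Ω : Type*} [MeasurableSpace Ω] (μ : MeasureTheory.Measure Ω)
    (H : Ω → Channel N K) (k : Fin K) (R P : ℝ) : ℝ :=
  μ.real {ω | Real.logb 2 (1 + ‖H ω k‖ ^ 2 * P) < R}

/-- The outage probability `Pout`, a function of the transmit power (the noise variance being
one), has diversity order `D`. -/
def HasDiversityOrder (Pout : ℝ → ℝ) (D : ℝ) : Prop :=
  Filter.Tendsto (fun P => -(Real.log (Pout P) / Real.log P)) Filter.atTop (nhds D)

end

end MixtureBC

/-!
The outage events are squeezed between events about the channel gains `‖h k‖ ^ 2` alone, whose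
probabilities are of the exact order `P ^ (-N)`.

*Upper bound on the outage.* When the grouping algorithm removes a group `S` from the candidates,
the angle metric between `S` and the remaining candidates is at most `θ < 1`. Projecting out either
side therefore leaves every vector of the other side at least the share `1 - θ` of its energy.
Projecting off the channels of all users outside a group can be carried out one group at a time
(`projOff_union`), and this is what the algorithm does, so the effective channel of each user keeps
at least the share `(1 - θ) ^ K` of the energy of its channel, for every realization
(`GroupingState.Invariant`, `IsGrouping.partition`). The max-min beam loses at most another factor
`4 ^ K`, because any finite set of unit vectors has a common vector bounded away from being
orthogonal to each of them (`exists_inner_lower_bound`, `IsMaxMinBeam.le_norm_inner_sq`). The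
condition on the power fractions makes the SINR exceed `2 ^ R - 1` as soon as the received power
exceeds a constant. Hence no user is in outage unless some `‖h k‖ ^ 2` is below a constant multiple
of `1 / P` (`exists_le_rate`).

*Lower bound.* The rate of a user never exceeds the rate it would have alone with maximal-ratio
beamforming (`Transmission.IsMixture.rate_le`).

*Probabilities.* `‖h k‖ ^ 2` is a sum of squares of `2 N` independent standard Gaussian variables,
and a comparison of balls with cubes shows that it is below `ε` with a probability between constant
multiples of `ε ^ N` (`IsRayleighFading.exists_ball_bounds`). A function between two positive
multiples of `P ^ (-N)` has diversity order `N` (`hasDiversityOrder_of_bounds`).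
-/

namespace MixtureBC

/-! ### Zero-forcing projections and the angle metric -/

/-- Projecting off `V = W ⊔ U` can be done in two steps: off `W`, then off the image `U'` of `U`
under the first projection. -/
lemma starProjection_orthogonal_sup {E : Type*} [NormedAddCommGroup E] [InnerProductSpace ℂ E]
    [FiniteDimensional ℂ E] {V W U U' : Submodule ℂ E} (hVWU : V = W ⊔ U)
    (hU' : U' = U.map (Wᗮ.starProjection : E →ₗ[ℂ] E)) (x : E) :
    Vᗮ.starProjection x = U'ᗮ.starProjection (Wᗮ.starProjection x) := by
  have hWW : ∀ z, Wᗮ.starProjection z = z - W.starProjection z :=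
    fun z => Submodule.starProjection_orthogonal_val z
  have hUW : U' ≤ Wᗮ := by
    rw [hU']
    rintro _ ⟨u, _, rfl⟩
    exact Submodule.starProjection_apply_mem _ _
  have hUV : U' ≤ W ⊔ U := by
    rw [hU']
    rintro _ ⟨u, hu, rfl⟩
    simp only [ContinuousLinearMap.coe_coe, hWW]
    exact sub_mem (Submodule.mem_sup_right hu)
      (Submodule.mem_sup_left (Submodule.starProjection_apply_mem _ _))
  have hVU : U ≤ W ⊔ U' := by
    intro u hu
    have h1 : u = W.starProjection u + Wᗮ.starProjection u := by rw [hWW]; abel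
    rw [h1]
    exact add_mem (Submodule.mem_sup_left (Submodule.starProjection_apply_mem _ _))
      (Submodule.mem_sup_right (hU' ▸ ⟨u, hu, rfl⟩))
  have hV : V = W ⊔ U' :=
    hVWU.trans <| le_antisymm (sup_le le_sup_left hVU) (sup_le le_sup_left hUV)
  have hsplit : ∀ z, U'ᗮ.starProjection z = z - U'.starProjection z :=
    fun z => Submodule.starProjection_orthogonal_val z
  refine Submodule.eq_starProjection_of_mem_orthogonal ?_ ?_
  · rw [hV, ← Submodule.inf_orthogonal]
    refine ⟨?_, Submodule.starProjection_apply_mem _ _⟩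
    rw [hsplit]
    exact sub_mem (Submodule.starProjection_apply_mem _ _)
      (hUW (Submodule.starProjection_apply_mem _ _))
  · refine Submodule.le_orthogonal_orthogonal _ ?_
    rw [hsplit, hWW]
    have h2 : x - (x - W.starProjection x - U'.starProjection (x - W.starProjection x)) =
        W.starProjection x + U'.starProjection (x - W.starProjection x) := by abel
    rw [h2, hVWU]
    exact add_mem (Submodule.mem_sup_left (Submodule.starProjection_apply_mem _ _))
      (hUV (Submodule.starProjection_apply_mem _ _))

variable {N K : ℕ}

lemma projOff_union (h f : Channel N K) (A B : Finset (Fin K))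
    (hf : ∀ b ∈ B, f b = projOff h A (h b)) (x : CVec N) :
    projOff h (A ∪ B) x = projOff f B (projOff h A x) := by
  refine starProjection_orthogonal_sup (U := Submodule.span ℂ (h '' (B : Set (Fin K)))) ?_ ?_ x
  · rw [Finset.coe_union, Set.image_union, Submodule.span_union]
  · rw [Submodule.map_span, Set.image_image]
    congr 1
    exact Set.image_congr fun b hb => hf b hb

lemma projOff_empty (h : Channel N K) (x : CVec N) : projOff h ∅ x = x := by
  simp [projOff, Submodule.starProjection_top]

lemma norm_projOff_le (f : Channel N K) (S : Finset (Fin K)) (x : CVec N) :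
    ‖projOff f S x‖ ≤ ‖x‖ :=
  Submodule.norm_starProjection_apply_le _ _

lemma norm_sq_eq_projOnto_add_projOff (f : Channel N K) (S : Finset (Fin K)) (x : CVec N) :
    ‖x‖ ^ 2 = ‖projOnto f S x‖ ^ 2 + ‖projOff f S x‖ ^ 2 :=
  Submodule.norm_sq_eq_add_norm_sq_starProjection x _

/-- A vector at a small angle metric to a column space keeps a fixed share of its energy when the
column space is projected out. -/
lemma norm_sq_projOff_of_phi_le {θ : ℝ} (f : Channel N K) (S : Finset (Fin K)) (b : CVec N)
    (hb : phi f S b ≤ θ) : (1 - θ) * ‖b‖ ^ 2 ≤ ‖projOff f S b‖ ^ 2 := by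
  have h := norm_sq_eq_projOnto_add_projOff f S b
  rcases eq_or_ne b 0 with rfl | hb0
  · simp
  · have hpos : 0 < ‖b‖ ^ 2 := by positivity
    rw [phi, div_le_iff₀ hpos] at hb
    linarith

lemma theta_comm (f : Channel N K) (A B : Finset (Fin K)) : theta f A B = theta f B A := by
  unfold theta
  by_cases h : A.Nonempty ∧ B.Nonempty
  · rw [dif_pos h, dif_pos h.symm, max_comm]
  · rw [dif_neg h, dif_neg fun h' => h h'.symm]

lemma norm_sq_projOff_of_theta_le {θ : ℝ} (hθ : 0 ≤ θ) (f : Channel N K) (A B : Finset (Fin K))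
    (h : theta f A B ≤ θ) {b : Fin K} (hb : b ∈ B) :
    (1 - θ) * ‖f b‖ ^ 2 ≤ ‖projOff f A (f b)‖ ^ 2 := by
  rcases A.eq_empty_or_nonempty with rfl | hA
  · rw [projOff_empty]
    nlinarith [mul_nonneg hθ (sq_nonneg ‖f b‖)]
  · refine norm_sq_projOff_of_phi_le f A _ (le_trans ?_ h)
    rw [theta, dif_pos ⟨hA, b, hb⟩]
    exact (Finset.le_sup' (fun b => phi f A (f b)) hb).trans (le_max_left _ _)

/-! ### The grouping algorithm -/

/-- Loop invariant of the grouping algorithm for the channel `h`: the groups found so far are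
pairwise disjoint and cover exactly the users that have left the candidate set, the current
vectors are the channels with the channels of all grouped users projected out, and every
projection so far has cost at most the factor `1 - θ` in energy, at most one factor for each
grouped user. -/
structure GroupingState.Invariant (θ : ℝ) (h : Channel N K) (s : GroupingState N K) : Prop where
  size_pos : 1 ≤ s.size
  vec_eq : ∀ u ∈ s.cand, s.vec u = projOff h s.candᶜ (h u)
  le_vec : ∀ u ∈ s.cand, (1 - θ) ^ s.candᶜ.card * ‖h u‖ ^ 2 ≤ ‖s.vec u‖ ^ 2
  subset : ∀ S ∈ s.groups, S ⊆ s.candᶜ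
  cover : ∀ k ∈ s.candᶜ, ∃ S ∈ s.groups, k ∈ S
  unique : ∀ S ∈ s.groups, ∀ T ∈ s.groups, ∀ k, k ∈ S → k ∈ T → S = T
  le_eff : ∀ S ∈ s.groups, ∀ u ∈ S, (1 - θ) ^ K * ‖h u‖ ^ 2 ≤ ‖effChannel h S u‖ ^ 2

lemma GroupingState.invariant_init (θ : ℝ) (h : Channel N K) :
    (GroupingState.init h).Invariant θ h where
  size_pos := le_rfl
  vec_eq u _ := by simp [GroupingState.init, projOff_empty]
  le_vec u _ := by simp [GroupingState.init]
  subset S hS := by simp [GroupingState.init] at hS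
  cover k hk := by simp [GroupingState.init] at hk
  unique S hS := by simp [GroupingState.init] at hS
  le_eff S hS := by simp [GroupingState.init] at hS

lemma GroupingState.Invariant.step {θ : ℝ} (hθ0 : 0 ≤ θ) (hθ1 : θ < 1) {h : Channel N K}
    {s t : GroupingState N K} (hs : s.Invariant θ h) (hst : GroupingStep θ s t) :
    t.Invariant θ h := by
  have h1θ : 0 ≤ 1 - θ := by linarith
  have h1θ' : 1 - θ ≤ 1 := by linarith
  cases hst with
  | notFound hsize hS =>
    exact ⟨hs.size_pos.trans (Nat.le_succ _), hs.vec_eq, hs.le_vec, hs.subset, hs.cover,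
      hs.unique, hs.le_eff⟩
  | found S hsize hS =>
    obtain ⟨hSc, hcard, hth⟩ := hS
    have hSpos : 1 ≤ S.card := hcard ▸ hs.size_pos
    have hcompl : (s.cand \ S)ᶜ = s.candᶜ ∪ S := by
      ext k; simp only [Finset.mem_compl, Finset.mem_sdiff, Finset.mem_union]; tauto
    have hScompl : Sᶜ = s.candᶜ ∪ (s.cand \ S) := by
      ext k
      have := @hSc k
      simp only [Finset.mem_compl, Finset.mem_sdiff, Finset.mem_union]; tauto
    have hdisj : Disjoint s.candᶜ S :=
      (Finset.disjoint_left.2 fun k hk hkS => (Finset.mem_compl.1 hk) (hSc hkS))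
    have hcc : (s.candᶜ ∪ S).card = s.candᶜ.card + S.card := Finset.card_union_of_disjoint hdisj
    have hcK : s.candᶜ.card + S.card ≤ K := by
      rw [← hcc]; exact (Finset.card_le_univ _).trans (by simp)
    refine ⟨hs.size_pos, ?_, ?_, ?_, ?_, ?_, ?_⟩
    · intro u hu
      have hu' := (Finset.mem_sdiff.1 hu).1
      simp only [hcompl]
      rw [projOff_union h s.vec _ _ (fun b hb => hs.vec_eq b (hSc hb)), ← hs.vec_eq u hu']
    · intro u hu
      have hu' := (Finset.mem_sdiff.1 hu).1
      simp only [hcompl, hcc]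
      calc (1 - θ) ^ (s.candᶜ.card + S.card) * ‖h u‖ ^ 2
          ≤ (1 - θ) ^ (s.candᶜ.card + 1) * ‖h u‖ ^ 2 := by
            gcongr ?_ * _
            exact pow_le_pow_of_le_one h1θ h1θ' (by omega)
        _ = (1 - θ) * ((1 - θ) ^ s.candᶜ.card * ‖h u‖ ^ 2) := by ring
        _ ≤ (1 - θ) * ‖s.vec u‖ ^ 2 := by gcongr; exact hs.le_vec u hu'
        _ ≤ _ := norm_sq_projOff_of_theta_le hθ0 s.vec S (s.cand \ S)
            (by rw [theta_comm]; exact hth) hu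
    · intro T hT
      simp only [hcompl]
      rcases List.mem_append.1 hT with hT | hT
      · exact (hs.subset T hT).trans Finset.subset_union_left
      · rw [List.mem_singleton.1 hT]; exact Finset.subset_union_right
    · intro k hk
      simp only [hcompl] at hk
      rcases Finset.mem_union.1 hk with hk | hk
      · obtain ⟨T, hT, hkT⟩ := hs.cover k hk
        exact ⟨T, List.mem_append_left _ hT, hkT⟩
      · exact ⟨S, List.mem_append_right _ (by simp), hk⟩
    · intro T hT T' hT' k hk hk'
      rcases List.mem_append.1 hT with hT | hT <;> rcases List.mem_append.1 hT' with hT' | hT'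
      · exact hs.unique T hT T' hT' k hk hk'
      · rw [List.mem_singleton.1 hT'] at hk'
        exact absurd hk' (Finset.disjoint_left.1 hdisj (hs.subset T hT hk))
      · rw [List.mem_singleton.1 hT] at hk
        exact absurd hk (Finset.disjoint_left.1 hdisj (hs.subset T' hT' hk'))
      · rw [List.mem_singleton.1 hT, List.mem_singleton.1 hT']
    · intro T hT u hu
      rcases List.mem_append.1 hT with hT | hT
      · exact hs.le_eff T hT u hu
      · rw [List.mem_singleton.1 hT] at hu ⊢
        have heff : effChannel h S u = projOff s.vec (s.cand \ S) (s.vec u) := by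
          rw [effChannel, hScompl, projOff_union h s.vec _ _
            (fun b hb => hs.vec_eq b (Finset.mem_sdiff.1 hb).1), ← hs.vec_eq u (hSc hu)]
        rw [heff]
        calc (1 - θ) ^ K * ‖h u‖ ^ 2
            ≤ (1 - θ) ^ (s.candᶜ.card + 1) * ‖h u‖ ^ 2 := by
              gcongr ?_ * _
              exact pow_le_pow_of_le_one h1θ h1θ' (by omega)
          _ = (1 - θ) * ((1 - θ) ^ s.candᶜ.card * ‖h u‖ ^ 2) := by ring
          _ ≤ (1 - θ) * ‖s.vec u‖ ^ 2 := by gcongr; exact hs.le_vec u (hSc hu)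
          _ ≤ _ := norm_sq_projOff_of_theta_le hθ0 s.vec _ S hth hu

lemma GroupingState.invariant_of_reflTransGen {θ : ℝ} (hθ0 : 0 ≤ θ) (hθ1 : θ < 1)
    {h : Channel N K} {s : GroupingState N K}
    (hs : Relation.ReflTransGen (GroupingStep θ) (GroupingState.init h) s) :
    s.Invariant θ h := by
  induction hs with
  | refl => exact GroupingState.invariant_init θ h
  | tail _ hst ih => exact ih.step hθ0 hθ1 hst

/-- The groups produced by the algorithm partition the users, and within its group each user
keeps a fixed share of its channel energy after inter-group zero-forcing. -/
lemma IsGrouping.partition {θ : ℝ} (hθ0 : 0 ≤ θ) (hθ1 : θ < 1) {h : Channel N K}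
    {G : List (Finset (Fin K))} (hG : IsGrouping θ h G) :
    (∀ k, ∃ S ∈ G, k ∈ S) ∧ (∀ S ∈ G, ∀ T ∈ G, ∀ k, k ∈ S → k ∈ T → S = T) ∧
      ∀ S ∈ G, ∀ u ∈ S, (1 - θ) ^ K * ‖h u‖ ^ 2 ≤ ‖effChannel h S u‖ ^ 2 := by
  obtain ⟨s, hs, -, rfl⟩ := hG
  have hI := GroupingState.invariant_of_reflTransGen hθ0 hθ1 hs
  have hmem : ∀ S, S ∈ s.groups ++ (if s.cand.Nonempty then [s.cand] else []) ↔
      S ∈ s.groups ∨ (s.cand.Nonempty ∧ S = s.cand) := by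
    intro S
    by_cases hc : s.cand.Nonempty <;> simp [hc]
  simp only [hmem]
  refine ⟨fun k => ?_, ?_, ?_⟩
  · by_cases hk : k ∈ s.cand
    · exact ⟨s.cand, Or.inr ⟨⟨k, hk⟩, rfl⟩, hk⟩
    · obtain ⟨S, hS, hkS⟩ := hI.cover k (Finset.mem_compl.2 hk)
      exact ⟨S, Or.inl hS, hkS⟩
  · rintro S (hS | ⟨-, rfl⟩) T (hT | ⟨-, rfl⟩) k hk hk'
    · exact hI.unique S hS T hT k hk hk'
    · exact absurd hk' (Finset.mem_compl.1 (hI.subset S hS hk))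
    · exact absurd hk (Finset.mem_compl.1 (hI.subset T hT hk'))
    · rfl
  · rintro S (hS | ⟨-, rfl⟩) u hu
    · exact hI.le_eff S hS u hu
    · rw [effChannel, ← hI.vec_eq u hu]
      refine le_trans ?_ (hI.le_vec u hu)
      gcongr ?_ * _
      exact pow_le_pow_of_le_one (by linarith) (by linarith)
        ((Finset.card_le_univ _).trans (by simp))

lemma groupOf_eq {G : List (Finset (Fin K))}
    (huniq : ∀ S ∈ G, ∀ T ∈ G, ∀ k, k ∈ S → k ∈ T → S = T) {S : Finset (Fin K)} (hS : S ∈ G)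
    {k : Fin K} (hk : k ∈ S) : groupOf G k = S := by
  ext j
  simp only [groupOf, Finset.mem_filter, Finset.mem_univ, true_and]
  exact ⟨fun ⟨T, hT, hkT, hjT⟩ => huniq T hT S hS k hkT hk ▸ hjT, fun hj => ⟨S, hS, hk, hj⟩⟩

/-- Each pass shrinks the candidate set or raises the group size, so the loop ends. -/
lemma exists_isGrouping (θ : ℝ) (h : Channel N K) : ∃ G, IsGrouping θ h G := by
  have key : ∀ n (s : GroupingState N K), 1 ≤ s.size → (K + 1 - s.size) + s.cand.card ≤ n →
      ∃ t, Relation.ReflTransGen (GroupingStep θ) s t ∧ K < t.size := by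
    intro n
    induction n with
    | zero => exact fun s _ hn => ⟨s, .refl, by omega⟩
    | succ n ih =>
      intro s hs hn
      by_cases hK : K < s.size
      · exact ⟨s, .refl, hK⟩
      push Not at hK
      by_cases hA : ∃ S, s.Admissible θ S
      · obtain ⟨S, hS⟩ := hA
        obtain ⟨t, ht, htK⟩ := ih
          { cand := s.cand \ S
            vec := fun u => projOff s.vec S (s.vec u)
            size := s.size
            groups := s.groups ++ [S] } hs (by
          change (K + 1 - s.size) + (s.cand \ S).card ≤ n
          have h1 := Finset.card_sdiff_add_card_eq_card hS.1
          have h2 := hS.2.1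
          omega)
        exact ⟨t, .head (.found s S hK hS) ht, htK⟩
      · push Not at hA
        obtain ⟨t, ht, htK⟩ := ih { s with size := s.size + 1 } (by simp) (by
          change (K + 1 - (s.size + 1)) + s.cand.card ≤ n
          omega)
        exact ⟨t, .head (.notFound s hK hA) ht, htK⟩
  obtain ⟨t, ht, htK⟩ := key _ (GroupingState.init h) le_rfl le_rfl
  exact ⟨_, t, ht, htK, rfl⟩

/-! ### Max-min beams -/

/-- Finitely many unit vectors have a common vector of norm at most one that is nearly orthogonal
to none of them, with a bound that depends on their number only. -/
lemma exists_inner_lower_bound {E ι : Type*} [NormedAddCommGroup E] [InnerProductSpace ℂ E]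
    (u : ι → E) (S : Finset ι) (hu : ∀ i ∈ S, ‖u i‖ = 1) :
    ∃ v : E, ‖v‖ ≤ 1 - (1 / 2) ^ S.card ∧ ∀ i ∈ S, (1 / 2) ^ S.card ≤ ‖inner ℂ (u i) v‖ := by
  classical
  induction S using Finset.induction_on with
  | empty => exact ⟨0, by simp, by simp⟩
  | insert a S ha ih =>
    obtain ⟨v, hv, hi⟩ := ih fun i hi => hu i (Finset.mem_insert_of_mem hi)
    have hua : ‖u a‖ = 1 := hu a (Finset.mem_insert_self _ _)
    rw [Finset.card_insert_of_notMem ha]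
    set c : ℝ := (1 / 2) ^ (S.card + 1) with hc
    have hc0 : 0 < c := by positivity
    have hcS : (1 / 2 : ℝ) ^ S.card = 2 * c := by rw [hc, pow_succ]; ring
    rw [hcS] at hv hi
    have haa : inner ℂ (u a) (u a) = (1 : ℂ) := by
      rw [inner_self_eq_norm_sq_to_K, hua]; simp
    -- Moving `v` by `± c` along `u a` costs the other inner products at most `c`, and the two
    -- resulting inner products with `u a` differ by `2 c`, so one of them is at least `c`.
    have key : ∀ z : ℂ, ‖z‖ = c → c ≤ ‖inner ℂ (u a) (v + z • u a)‖ →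
        ∃ v' : E, ‖v'‖ ≤ 1 - c ∧ ∀ i ∈ insert a S, c ≤ ‖inner ℂ (u i) v'‖ := by
      intro z hz hza
      refine ⟨v + z • u a, ?_, ?_⟩
      · have h1 := norm_add_le v (z • u a)
        rw [norm_smul, hz, hua] at h1
        linarith
      · intro i his
        rcases Finset.mem_insert.1 his with rfl | his'
        · exact hza
        · have h1 : ‖inner ℂ (u i) (z • u a)‖ ≤ c := by
            refine (norm_inner_le_norm _ _).trans ?_
            rw [norm_smul, hz, hua, hu i his]
            linarith
          have h2 := hi i his'
          rw [inner_add_right]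
          have h3 := norm_sub_le_norm_add (inner ℂ (u i) v) (inner ℂ (u i) (z • u a))
          linarith
    by_cases hp : c ≤ ‖inner ℂ (u a) (v + (c : ℂ) • u a)‖
    · exact key c (by simp [abs_of_pos hc0]) hp
    · refine key (-c) (by simp [abs_of_pos hc0]) ?_
      push Not at hp
      rw [inner_add_right, inner_smul_right, haa, mul_one] at hp ⊢
      have h1 : ‖(2 * c : ℂ)‖ = 2 * c := by simp [abs_of_pos hc0]
      have h2 := norm_sub_le (inner ℂ (u a) v + (c : ℂ)) (inner ℂ (u a) v + -(c : ℂ))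
      rw [show inner ℂ (u a) v + (c : ℂ) - (inner ℂ (u a) v + -(c : ℂ)) = 2 * c by ring, h1] at h2
      linarith

/-- A max-min beam catches a fixed share of the energy of each effective channel. -/
lemma IsMaxMinBeam.le_norm_inner_sq {g : Channel N K} {S : Finset (Fin K)} {w : CVec N}
    (hw : IsMaxMinBeam g S w) (hg : ∀ i ∈ S, g i ≠ 0) {j : Fin K} (hj : j ∈ S) :
    (1 / 4) ^ K * ‖g j‖ ^ 2 ≤ ‖inner ℂ (g j) w‖ ^ 2 := by
  have hpos : ∀ i ∈ S, 0 < ‖g i‖ := fun i hi => norm_pos_iff.2 (hg i hi)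
  obtain ⟨v, hv, hvi⟩ := exists_inner_lower_bound (fun i => ((‖g i‖⁻¹ : ℝ) : ℂ) • g i) S
    (fun i hi => by
      have := hpos i hi
      rw [norm_smul, Complex.norm_real, norm_inv, norm_norm, inv_mul_cancel₀ this.ne'])
  have hv1 : ‖v‖ ^ 2 ≤ 1 := by
    have : ‖v‖ ≤ 1 := hv.trans (sub_le_self _ (by positivity))
    exact pow_le_one₀ (norm_nonneg _) this
  have : Nonempty S := ⟨⟨j, hj⟩⟩
  have h1 : (1 / 4 : ℝ) ^ K ≤ ⨅ i : S, ‖inner ℂ (((‖g i‖⁻¹ : ℝ) : ℂ) • g i) v‖ ^ 2 := by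
    refine le_ciInf fun i => ?_
    calc (1 / 4 : ℝ) ^ K ≤ (1 / 4) ^ S.card :=
          pow_le_pow_of_le_one (by norm_num) (by norm_num)
            ((Finset.card_le_univ _).trans (by simp))
      _ = ((1 / 2) ^ S.card) ^ 2 := by rw [← pow_mul, mul_comm, pow_mul]; norm_num
      _ ≤ _ := pow_le_pow_left₀ (by positivity) (hvi i i.2) 2
  have h2 : (⨅ i : S, ‖inner ℂ (((‖g i‖⁻¹ : ℝ) : ℂ) • g i) w‖ ^ 2) ≤
      ‖inner ℂ (((‖g j‖⁻¹ : ℝ) : ℂ) • g j) w‖ ^ 2 :=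
    ciInf_le (f := fun i : S => ‖inner ℂ (((‖g i‖⁻¹ : ℝ) : ℂ) • g i) w‖ ^ 2)
      (Set.finite_range _).bddBelow ⟨j, hj⟩
  have h3 := (h1.trans (hw.2 v hv1)).trans h2
  have hgj := hpos j hj
  rw [inner_smul_left, norm_mul, RCLike.norm_conj, Complex.norm_real, norm_inv, norm_norm,
    mul_pow, inv_pow, ← div_eq_inv_mul, le_div_iff₀ (by positivity)] at h3
  exact h3

lemma exists_isMaxMinBeam (g : Channel N K) (S : Finset (Fin K)) : ∃ w, IsMaxMinBeam g S w := by
  have hcont : Continuous fun v : CVec N =>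
      ⨅ i : S, ‖inner ℂ (((‖g i‖⁻¹ : ℝ) : ℂ) • g i) v‖ ^ 2 := by
    rcases isEmpty_or_nonempty S with hS | hS
    · simp only [Real.iInf_of_isEmpty]; exact continuous_const
    · simp only [← Finset.inf'_univ_eq_ciInf]
      exact Continuous.finset_inf'_apply _ fun i _ => by fun_prop
  obtain ⟨w, hw, hmax⟩ := (isCompact_closedBall (0 : CVec N) 1).exists_isMaxOn
    ⟨0, by simp⟩ hcont.continuousOn
  have hball : ∀ v : CVec N, ‖v‖ ^ 2 ≤ 1 ↔ v ∈ Metric.closedBall (0 : CVec N) 1 := fun v => by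
    rw [mem_closedBall_zero_iff, sq_le_one_iff₀ (norm_nonneg v)]
  exact ⟨w, (hball w).2 hw, fun v hv => hmax ((hball v).1 hv)⟩

/-! ### Power distributions -/

lemma one_lt_two_rpow {R : ℝ} (hR : 0 < R) : 1 < (2 : ℝ) ^ R :=
  Real.one_lt_rpow (by norm_num) hR

/-- Fractions growing geometrically with ratio `2 ^ R` work, since `∑ m < i, r ^ m` is
`(r ^ i - 1) / (r - 1)`. -/
lemma exists_isPowerDistribution {R : ℝ} (hR : 0 < R) :
    ∃ δ : Finset (Fin K) → ℕ → ℝ, IsPowerDistribution R δ := by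
  have hr := one_lt_two_rpow hR
  set r : ℝ := 2 ^ R
  have hr0 : 0 < r := by linarith
  have hsum : ∀ S : Finset (Fin K), S.Nonempty → 0 < ∑ m ∈ Finset.range S.card, r ^ m :=
    fun S hS => Finset.sum_pos (fun _ _ => by positivity)
      (Finset.nonempty_range_iff.2 hS.card_pos.ne')
  have hne : ∀ {S : Finset (Fin K)} {i : ℕ}, i < S.card → S.Nonempty :=
    fun hi => Finset.card_pos.1 (by omega)
  refine ⟨fun S i => r ^ i / ∑ m ∈ Finset.range S.card, r ^ m, ?_, ?_, ?_⟩
  · exact fun S i hi => div_pos (by positivity) (hsum S (hne hi))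
  · exact fun S hS => by rw [← Finset.sum_div, div_self (hsum S hS).ne']
  · intro S i hi _
    have hs := hsum S (hne hi)
    set s := ∑ m ∈ Finset.range S.card, r ^ m
    rw [← Finset.sum_div, geom_sum_eq hr.ne']
    have : r ^ i / s / (r - 1) - (r ^ i - 1) / (r - 1) / s = 1 / ((r - 1) * s) := by
      have : r - 1 ≠ 0 := by linarith
      field_simp
      ring
    rw [this]
    exact one_div_pos.2 (mul_pos (by linarith) hs)

lemma IsPowerDistribution.le_one {R : ℝ} {δ : Finset (Fin K) → ℕ → ℝ}
    (hδ : IsPowerDistribution R δ) {S : Finset (Fin K)} {i : ℕ} (hi : i < S.card) :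
    δ S i ≤ 1 := by
  rw [← hδ.sum_eq_one S (Finset.card_pos.1 (by omega))]
  exact Finset.single_le_sum (fun j hj => (hδ.pos S j (Finset.mem_range.1 hj)).le)
    (Finset.mem_range.2 hi)

/-- The gaps between the scaled power fraction of a user and the interference it sees are bounded
away from zero, there being finitely many groups and positions. -/
lemma IsPowerDistribution.exists_gap {R : ℝ} (hR : 0 < R) {δ : Finset (Fin K) → ℕ → ℝ}
    (hδ : IsPowerDistribution R δ) : ∃ η > 0, ∀ S : Finset (Fin K), ∀ i < S.card,
      η ≤ δ S i / ((2 : ℝ) ^ R - 1) - ∑ m ∈ Finset.range i, δ S m := by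
  have ha : 0 < (2 : ℝ) ^ R - 1 := sub_pos.2 (one_lt_two_rpow hR)
  let f : (Σ S : Finset (Fin K), Fin S.card) → ℝ := fun x =>
    δ x.1 x.2 / ((2 : ℝ) ^ R - 1) - ∑ m ∈ Finset.range x.2, δ x.1 m
  have hf : ∀ x, 0 < f x := by
    rintro ⟨S, i, hi⟩
    rcases Nat.eq_zero_or_pos i with rfl | hi0
    · simpa [f] using div_pos (hδ.pos S 0 hi) ha
    · exact hδ.gap S i hi hi0
  rcases isEmpty_or_nonempty (Σ S : Finset (Fin K), Fin S.card) with he | he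
  · exact ⟨1, one_pos, fun S i hi => (he.false ⟨S, i, hi⟩).elim⟩
  · obtain ⟨x, hx⟩ := Finite.exists_min f
    exact ⟨f x, hf x, fun S i hi => hx ⟨S, i, hi⟩⟩

/-! ### Rates of a mixture transmission -/

/-- The users of `S` can be ranked by decreasing `a`: the rank of a user counts the users before it,
ties being broken by index. -/
lemma exists_rank (S : Finset (Fin K)) (a : Fin K → ℝ) :
    ∃ r : Fin K → ℕ, Set.BijOn r (S : Set (Fin K)) (Set.Iio S.card) ∧
      ∀ i ∈ S, ∀ j ∈ S, r i < r j → a j ≤ a i := by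
  classical
  let key : Fin K → ℝ ×ₗ Fin K := fun i => toLex (-a i, i)
  have hkey : Function.Injective key := fun i j hij => by
    have := congrArg (fun x => (ofLex x).2) hij
    exact this
  let r : Fin K → ℕ := fun i => (S.filter fun j => key j < key i).card
  have hmono : ∀ i ∈ S, ∀ j, key i < key j → r i < r j := by
    intro i hi j hij
    refine Finset.card_lt_card (Finset.ssubset_iff_of_subset ?_ |>.2 ⟨i, ?_, ?_⟩)
    · exact fun k hk => by
        simp only [Finset.mem_filter] at hk ⊢
        exact ⟨hk.1, hk.2.trans hij⟩
    · simp [hi, hij]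
    · simp
  have hmaps : Set.MapsTo r (S : Set (Fin K)) (Set.Iio S.card) := fun i hi =>
    Finset.card_lt_card (Finset.filter_ssubset.2 ⟨i, hi, lt_irrefl _⟩)
  have hinj : Set.InjOn r (S : Set (Fin K)) := by
    intro i hi j hj hij
    rcases lt_trichotomy (key i) (key j) with h | h | h
    · exact absurd hij (hmono i hi j h).ne
    · exact hkey h
    · exact absurd hij (hmono j hj i h).ne'
  refine ⟨r, ⟨hmaps, hinj, ?_⟩, ?_⟩
  · have := Finset.surjOn_of_injOn_of_card_le (s := S) (t := Finset.range S.card) r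
      (by simpa using hmaps) hinj (by simp)
    simpa using this
  · intro i hi j hj hij
    have hle : key i ≤ key j := by
      by_contra hlt
      exact absurd (hmono j hj i (not_le.1 hlt)) hij.not_gt
    rcases Prod.Lex.le_iff.1 hle with h | h
    · exact (neg_lt_neg_iff.1 h).le
    · exact (neg_injective h.1).ge

lemma exists_isMixture {θ : ℝ} (hθ0 : 0 ≤ θ) (hθ1 : θ < 1) (h : Channel N K) :
    ∃ t : Transmission N K, t.IsMixture θ h := by
  obtain ⟨G, hG⟩ := exists_isGrouping θ h
  obtain ⟨-, huniq, -⟩ := hG.partition hθ0 hθ1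
  choose r hr hr' using fun S : Finset (Fin K) => exists_rank S fun k => ‖effChannel h S k‖ ^ 2
  choose w hw using fun S : Finset (Fin K) => exists_isMaxMinBeam (effChannel h S) S
  have hgr : ∀ {S}, S ∈ G → ∀ {k}, k ∈ S → groupOf G k = S := fun hS _ hk =>
    groupOf_eq huniq hS hk
  refine ⟨⟨G, fun k => r (groupOf G k) k, fun k => w (groupOf G k)⟩, hG, ?_, ?_, ?_⟩
  · intro S hS
    exact (hr S).congr fun k hk => by simp only [hgr hS hk]
  · intro S hS a ha b hb hab
    simp only [hgr hS ha, hgr hS hb] at hab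
    exact hr' S a ha b hb hab
  · exact fun S hS => ⟨w S, hw S, fun k hk => by simp only [hgr hS hk]⟩

/-- Superposition coding and zero-forcing only lose rate against a transmission to the user alone,
so a user in outage under maximal-ratio beamforming is in outage here. -/
lemma Transmission.IsMixture.rate_le {θ R : ℝ} (hθ0 : 0 ≤ θ) (hθ1 : θ < 1) {h : Channel N K}
    {t : Transmission N K} (ht : t.IsMixture θ h) {δ : Finset (Fin K) → ℕ → ℝ}
    (hδ : IsPowerDistribution R δ) {P : ℝ} (hP : 0 ≤ P) (k : Fin K) :
    t.rate δ h P k ≤ Real.logb 2 (1 + ‖h k‖ ^ 2 * P) := by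
  obtain ⟨hcov, huniq, -⟩ := ht.grouping.partition hθ0 hθ1
  obtain ⟨S, hS, hk⟩ := hcov k
  have hgr := groupOf_eq huniq hS hk
  obtain ⟨w, hw, hbeam⟩ := ht.beam S hS
  simp only [Transmission.rate, hgr]
  unfold sicRate
  set p : Fin K → ℝ := fun m => δ S (t.rank m) * ((S.card : ℝ) * (P / K)) with hp
  have hrank : ∀ m ∈ S, t.rank m < S.card := fun m hm => (ht.rank_bijOn S hS).mapsTo hm
  have hK : (0 : ℝ) < K := Nat.cast_pos.2 (Fin.pos k)
  have hp0 : ∀ m ∈ S, 0 ≤ p m := fun m hm =>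
    mul_nonneg (hδ.pos S _ (hrank m hm)).le (by positivity)
  have hden : ∀ j, 1 ≤ (∑ m ∈ S with t.rank m < t.rank k,
      p m * ‖inner ℂ (effChannel h S j) (t.beam m)‖ ^ 2) + 1 := fun j =>
    le_add_of_nonneg_left (Finset.sum_nonneg fun m hm =>
      mul_nonneg (hp0 m (Finset.mem_filter.1 hm).1) (sq_nonneg _))
  have hnn : ∀ j, 0 ≤ sinr (effChannel h S) S t.rank t.beam p j k := fun j =>
    div_nonneg (mul_nonneg (hp0 k hk) (sq_nonneg _)) (zero_le_one.trans (hden j))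
  have hpP : p k ≤ P := by
    have h1 : (S.card : ℝ) ≤ K := by
      exact_mod_cast (Finset.card_le_univ S).trans (by simp)
    have h2 : (S.card : ℝ) * (P / K) ≤ P := by
      rw [mul_div_assoc', div_le_iff₀ hK]
      nlinarith
    exact (mul_le_of_le_one_left (by positivity) (hδ.le_one (hrank k hk))).trans h2
  have hgain : ‖inner ℂ (effChannel h S k) (t.beam k)‖ ^ 2 ≤ ‖h k‖ ^ 2 := by
    rw [hbeam k hk]
    have h1 : ‖w‖ ≤ 1 := (sq_le_one_iff₀ (norm_nonneg w)).1 hw.1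
    have h2 : ‖effChannel h S k‖ ≤ ‖h k‖ := norm_projOff_le _ _ _
    refine pow_le_pow_left₀ (norm_nonneg _) ((norm_inner_le_norm _ _).trans ?_) 2
    exact (mul_le_of_le_one_right (norm_nonneg _) h1).trans h2
  have hkk : sinr (effChannel h S) S t.rank t.beam p k k ≤ ‖h k‖ ^ 2 * P := by
    calc sinr (effChannel h S) S t.rank t.beam p k k
        ≤ p k * ‖inner ℂ (effChannel h S k) (t.beam k)‖ ^ 2 :=
          div_le_self (mul_nonneg (hp0 k hk) (sq_nonneg _)) (hden k)
      _ ≤ P * ‖h k‖ ^ 2 := mul_le_mul hpP hgain (sq_nonneg _) hP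
      _ = _ := mul_comm _ _
  have hinf := ciInf_le_of_le (f := fun j : {j : Fin K // j ∈ S ∧ t.rank j ≤ t.rank k} =>
    sinr (effChannel h S) S t.rank t.beam p j k) (Set.finite_range _).bddBelow
    ⟨k, hk, le_rfl⟩ hkk
  have hinf0 : 0 ≤ ⨅ j : {j : Fin K // j ∈ S ∧ t.rank j ≤ t.rank k},
      sinr (effChannel h S) S t.rank t.beam p j k := Real.iInf_nonneg fun j => hnn j
  exact Real.logb_le_logb_of_le (by norm_num) (add_pos_of_pos_of_nonneg one_pos hinf0)
    (add_le_add le_rfl hinf)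

/-- No user is in outage once every channel gain exceeds a fixed multiple of `1 / P`. -/
lemma exists_le_rate {θ R : ℝ} (hθ0 : 0 ≤ θ) (hθ1 : θ < 1) (hR : 0 < R)
    {δ : Finset (Fin K) → ℕ → ℝ} (hδ : IsPowerDistribution R δ) :
    ∃ C > 0, ∀ (h : Channel N K) (t : Transmission N K), t.IsMixture θ h → ∀ P > 0,
      (∀ k, C ≤ ‖h k‖ ^ 2 * P) → ∀ k, R ≤ t.rate δ h P k := by
  rcases Nat.eq_zero_or_pos K with rfl | hK
  · exact ⟨1, one_pos, fun h t ht P hP hh k => k.elim0⟩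
  obtain ⟨η, hη, hgap⟩ := hδ.exists_gap hR
  have h1θ : 0 < 1 - θ := by linarith
  have hK' : (0 : ℝ) < K := Nat.cast_pos.2 hK
  refine ⟨K / (η * ((1 / 4) ^ K * (1 - θ) ^ K)), by positivity, fun h t ht P hP hh k => ?_⟩
  obtain ⟨hcov, huniq, heff⟩ := ht.grouping.partition hθ0 hθ1
  obtain ⟨S, hS, hk⟩ := hcov k
  have hgr := groupOf_eq huniq hS hk
  obtain ⟨w, hw, hbeam⟩ := ht.beam S hS
  have hbij := ht.rank_bijOn S hS
  simp only [Transmission.rate, hgr]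
  unfold sicRate
  set q : ℝ := (S.card : ℝ) * (P / K) with hq
  have hSc : (1 : ℝ) ≤ S.card := by exact_mod_cast Finset.card_pos.2 ⟨k, hk⟩
  have hq0 : P / K ≤ q := le_mul_of_one_le_left (by positivity) hSc
  have hi : t.rank k < S.card := hbij.mapsTo hk
  have hhpos : ∀ j, 0 < ‖h j‖ ^ 2 := fun j =>
    pos_of_mul_pos_left (lt_of_lt_of_le (by positivity) (hh j)) hP.le
  have hg0 : ∀ i ∈ S, effChannel h S i ≠ 0 := by
    intro i hiS h0
    have h1 := heff S hS i hiS
    rw [h0, norm_zero] at h1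
    have h2 : 0 < (1 - θ) ^ K * ‖h i‖ ^ 2 := mul_pos (by positivity) (hhpos i)
    norm_num at h1
    linarith
  have ha : 0 < (2 : ℝ) ^ R - 1 := sub_pos.2 (one_lt_two_rpow hR)
  -- The received interference is a multiple of the sum of the fractions at smaller positions.
  have hinterf : ∀ j, (∑ m ∈ S with t.rank m < t.rank k,
      δ S (t.rank m) * q * ‖inner ℂ (effChannel h S j) (t.beam m)‖ ^ 2) =
      (∑ m ∈ Finset.range (t.rank k), δ S m) * q * ‖inner ℂ (effChannel h S j) w‖ ^ 2 := by
    intro j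
    rw [Finset.sum_mul, Finset.sum_mul]
    refine Finset.sum_bij (fun m _ => t.rank m) ?_ ?_ ?_ ?_
    · exact fun m hm => Finset.mem_range.2 (Finset.mem_filter.1 hm).2
    · exact fun m hm m' hm' hmm => hbij.injOn (Finset.mem_filter.1 hm).1
        (Finset.mem_filter.1 hm').1 hmm
    · intro b hb
      have hb' := Finset.mem_range.1 hb
      obtain ⟨m, hm, rfl⟩ := hbij.surjOn (show b ∈ Set.Iio S.card from hb'.trans hi)
      exact ⟨m, Finset.mem_filter.2 ⟨hm, hb'⟩, rfl⟩
    · exact fun m hm => by rw [hbeam m (Finset.mem_filter.1 hm).1]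
  have hsinr : ∀ j ∈ S, (2 : ℝ) ^ R - 1 ≤
      sinr (effChannel h S) S t.rank t.beam (fun m => δ S (t.rank m) * q) j k := by
    intro j hj
    set x := ‖inner ℂ (effChannel h S j) w‖ ^ 2 with hx
    have hxlow : (1 / 4) ^ K * (1 - θ) ^ K * ‖h j‖ ^ 2 ≤ x := by
      refine le_trans ?_ (hw.le_norm_inner_sq hg0 hj)
      rw [mul_assoc]
      exact mul_le_mul_of_nonneg_left (heff S hS j hj) (by positivity)
    have hint0 : 0 ≤ ∑ m ∈ Finset.range (t.rank k), δ S m := Finset.sum_nonneg fun m hm =>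
      (hδ.pos S m ((Finset.mem_range.1 hm).trans hi)).le
    have hqpos : 0 ≤ q := le_trans (by positivity) hq0
    rw [sinr, hinterf, hbeam k hk, ← hx, le_div_iff₀ (by positivity)]
    have hone : 1 ≤ η * (q * x) := by
      have h1 := hh j
      rw [div_le_iff₀ (by positivity)] at h1
      have h2 : (P / K) * ((1 / 4) ^ K * (1 - θ) ^ K * ‖h j‖ ^ 2) ≤ q * x :=
        mul_le_mul hq0 hxlow (by positivity) hqpos
      refine le_trans ?_ (mul_le_mul_of_nonneg_left h2 hη.le)
      rw [show η * (P / K * ((1 / 4) ^ K * (1 - θ) ^ K * ‖h j‖ ^ 2)) =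
        ‖h j‖ ^ 2 * P * (η * ((1 / 4) ^ K * (1 - θ) ^ K)) / K by ring, le_div_iff₀ hK']
      linarith
    have h3 := (hone.trans (mul_le_mul_of_nonneg_right (hgap S _ hi)
      (mul_nonneg hqpos (sq_nonneg _))))
    have h4 : δ S (t.rank k) / ((2 : ℝ) ^ R - 1) * ((2 : ℝ) ^ R - 1) = δ S (t.rank k) :=
      div_mul_cancel₀ _ ha.ne'
    calc ((2 : ℝ) ^ R - 1) * ((∑ m ∈ Finset.range (t.rank k), δ S m) * q * x + 1)
        ≤ ((2 : ℝ) ^ R - 1) * ((∑ m ∈ Finset.range (t.rank k), δ S m) * q * x +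
          (δ S (t.rank k) / ((2 : ℝ) ^ R - 1) - ∑ m ∈ Finset.range (t.rank k), δ S m) *
            (q * x)) := by gcongr
      _ = δ S (t.rank k) / ((2 : ℝ) ^ R - 1) * ((2 : ℝ) ^ R - 1) * q * x := by ring
      _ = _ := by rw [h4]
  have : Nonempty {j : Fin K // j ∈ S ∧ t.rank j ≤ t.rank k} := ⟨⟨k, hk, le_rfl⟩⟩
  have hinf : (2 : ℝ) ^ R - 1 ≤ ⨅ j : {j : Fin K // j ∈ S ∧ t.rank j ≤ t.rank k},
      sinr (effChannel h S) S t.rank t.beam (fun m => δ S (t.rank m) * q) j k :=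
    le_ciInf fun j => hsinr j j.2.1
  rw [Real.le_logb_iff_rpow_le (by norm_num) (add_pos_of_pos_of_nonneg one_pos (ha.le.trans hinf))]
  exact sub_le_iff_le_add'.1 hinf

open MeasureTheory ProbabilityTheory Filter

/-! ### Small-ball probabilities of the channel gains -/

/-- The Gaussian measure of a short interval around the origin is of the order of its length. -/
lemma exists_gaussian_Ioo_bounds : ∃ c > 0, ∃ C > 0, ∀ s : ℝ, 0 < s → s ≤ 1 →
    c * s ≤ (gaussianReal 0 1).real (Set.Ioo (-s) s) ∧
      (gaussianReal 0 1).real (Set.Ioo (-s) s) ≤ C * s := by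
  have hform : ∀ x : ℝ, gaussianPDFReal 0 1 x = (√(2 * Real.pi))⁻¹ * Real.exp (-x ^ 2 / 2) := by
    intro x; simp [gaussianPDFReal]
  set d : ℝ := (√(2 * Real.pi))⁻¹ with hd
  have hd0 : 0 < d := by positivity
  refine ⟨2 * (d * Real.exp (-1 / 2)), by positivity, 2 * d, by positivity, fun s hs hs1 => ?_⟩
  have hint : (gaussianReal 0 1).real (Set.Ioo (-s) s) =
      ∫ x in Set.Ioo (-s) s, gaussianPDFReal 0 1 x := by
    rw [measureReal_def, gaussianReal_apply_eq_integral 0 one_ne_zero, ENNReal.toReal_ofReal]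
    exact integral_nonneg fun x => gaussianPDFReal_nonneg 0 1 x
  have hvol : volume.real (Set.Ioo (-s) s) = 2 * s := by
    rw [Real.volume_real_Ioo_of_le (by linarith)]; ring
  have hI : IntegrableOn (gaussianPDFReal 0 1) (Set.Ioo (-s) s) :=
    (integrable_gaussianPDFReal 0 1).integrableOn
  have hconst : ∀ a : ℝ, ∫ _ in Set.Ioo (-s) s, a = 2 * s * a := fun a => by
    rw [setIntegral_const, hvol, smul_eq_mul]
  have hIc : ∀ a : ℝ, IntegrableOn (fun _ : ℝ => a) (Set.Ioo (-s) s) := fun a =>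
    integrableOn_const (by simp)
  rw [hint]
  constructor
  · rw [show 2 * (d * Real.exp (-1 / 2)) * s = 2 * s * (d * Real.exp (-1 / 2)) by ring, ← hconst]
    refine setIntegral_mono_on (hIc _) hI measurableSet_Ioo fun x hx => ?_
    rw [hform]
    gcongr
    have : |x| ≤ 1 := (abs_lt.2 hx).le.trans hs1
    nlinarith [(sq_le_one_iff_abs_le_one x).2 this]
  · rw [show 2 * d * s = 2 * s * d by ring, ← hconst]
    refine setIntegral_mono_on hI (hIc _) measurableSet_Ioo fun x hx => ?_
    rw [hform]
    refine mul_le_of_le_one_right hd0.le (Real.exp_le_one_iff.2 ?_)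
    nlinarith [sq_nonneg x]

lemma norm_sq_eq_sum_realCoord {Ω : Type*} (H : Ω → Channel N K) (k : Fin K) (ω : Ω) :
    ‖H ω k‖ ^ 2 = ∑ j : Fin N × Bool, realCoord H (k, j) ω ^ 2 := by
  rw [EuclideanSpace.norm_sq_eq, Fintype.sum_prod_type]
  refine Finset.sum_congr rfl fun n _ => ?_
  rw [← Complex.normSq_eq_norm_sq, Complex.normSq_apply]
  simp [realCoord]
  ring

variable {Ω : Type*} [MeasurableSpace Ω] {μ : Measure Ω} {H : Ω → Channel N K}

/-- By independence, the event that all `2 N` real coordinates of one channel lie in `(-s, s)` has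
the probability of a product. -/
lemma IsRayleighFading.measure_box (hH : IsRayleighFading μ H) (k : Fin K) (s : ℝ) :
    μ.real {ω | ∀ j : Fin N × Bool, realCoord H (k, j) ω ∈ Set.Ioo (-s) s} =
      (gaussianReal 0 1).real (Set.Ioo (-s) s) ^ (2 * N) := by
  classical
  have hind := (hH.indep.precomp (g := fun j : Fin N × Bool => (k, j))
    (fun _ _ h => (Prod.mk.inj h).2)).measure_inter_preimage_eq_mul Finset.univ
    (sets := fun _ => Set.Ioo (-s) s) (fun _ _ => measurableSet_Ioo)
  have hset : {ω | ∀ j : Fin N × Bool, realCoord H (k, j) ω ∈ Set.Ioo (-s) s} =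
      ⋂ j ∈ (Finset.univ : Finset (Fin N × Bool)),
        (fun ω => realCoord H (k, j) ω) ⁻¹' Set.Ioo (-s) s := by
    ext ω; simp
  rw [hset, measureReal_def, hind, ENNReal.toReal_prod]
  have hone : ∀ j : Fin N × Bool, (μ ((fun ω => realCoord H (k, j) ω) ⁻¹' Set.Ioo (-s) s)).toReal =
      (gaussianReal 0 1).real (Set.Ioo (-s) s) := fun j =>
    (hH.law (k, j)).measureReal_eq (p := fun x => x ∈ Set.Ioo (-s) s) measurableSet_Ioo
  rw [Finset.prod_congr rfl fun j _ => hone j, Finset.prod_const]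
  simp [mul_comm]

/-- The gain of one channel is below `ε` with a probability of order `ε ^ N`: the ball of radius
`√ε` lies between two cubes whose sides are of the order of `√ε`, in `2 N` real dimensions. -/
lemma IsRayleighFading.exists_ball_bounds [IsProbabilityMeasure μ] (hN : 1 ≤ N)
    (hH : IsRayleighFading μ H) :
    ∃ c > 0, ∃ C > 0, ∀ (k : Fin K) (ε : ℝ), 0 < ε → ε ≤ 1 →
      c * ε ^ N ≤ μ.real {ω | ‖H ω k‖ ^ 2 < ε} ∧ μ.real {ω | ‖H ω k‖ ^ 2 < ε} ≤ C * ε ^ N := by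
  obtain ⟨c, hc, C, hC, hcC⟩ := exists_gaussian_Ioo_bounds
  have hN' : (1 : ℝ) ≤ N := by exact_mod_cast hN
  refine ⟨(c * (√(2 * N))⁻¹) ^ (2 * N), by positivity, C ^ (2 * N), by positivity,
    fun k ε hε hε1 => ⟨?_, ?_⟩⟩
  · have hs : 0 < √ε * (√(2 * N))⁻¹ := by positivity
    have hs1 : √ε * (√(2 * N))⁻¹ ≤ 1 := by
      have h1 : √ε ≤ 1 := Real.sqrt_le_one.2 hε1
      have h2 : (√(2 * N))⁻¹ ≤ 1 := inv_le_one_of_one_le₀ (Real.one_le_sqrt.2 (by linarith))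
      exact mul_le_one₀ h1 (by positivity) h2
    have hsq : (√ε * (√(2 * N))⁻¹) ^ 2 = ε / (2 * N) := by
      rw [mul_pow, inv_pow, Real.sq_sqrt hε.le, Real.sq_sqrt (by positivity), div_eq_mul_inv]
    calc (c * (√(2 * N))⁻¹) ^ (2 * N) * ε ^ N
        = (c * (√ε * (√(2 * N))⁻¹)) ^ (2 * N) := by
          rw [show c * (√ε * (√(2 * N))⁻¹) = (c * (√(2 * N))⁻¹) * √ε by ring, mul_pow _ √ε,
            pow_mul √ε, Real.sq_sqrt hε.le]
      _ ≤ _ := pow_le_pow_left₀ (by positivity) (hcC _ hs hs1).1 _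
      _ = _ := (hH.measure_box k _).symm
      _ ≤ _ := by
        refine measureReal_mono fun ω hω => ?_
        have : Nonempty (Fin N × Bool) := ⟨(⟨0, hN⟩, true)⟩
        have hlt : ∀ j : Fin N × Bool, realCoord H (k, j) ω ^ 2 < ε / (2 * N) := fun j =>
          hsq ▸ sq_lt_sq' (hω j).1 (hω j).2
        change ‖H ω k‖ ^ 2 < ε
        rw [norm_sq_eq_sum_realCoord]
        refine (Finset.sum_lt_sum_of_nonempty Finset.univ_nonempty fun j _ => hlt j).trans_eq ?_
        simp
        field_simp
  · calc μ.real {ω | ‖H ω k‖ ^ 2 < ε}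
        ≤ μ.real {ω | ∀ j : Fin N × Bool, realCoord H (k, j) ω ∈ Set.Ioo (-√ε) √ε} := by
          refine measureReal_mono fun ω hω j => ?_
          refine abs_lt.1 (Real.lt_sqrt (abs_nonneg _) |>.2 ?_)
          rw [sq_abs]
          refine lt_of_le_of_lt ?_ (show ‖H ω k‖ ^ 2 < ε from hω)
          rw [norm_sq_eq_sum_realCoord]
          exact Finset.single_le_sum (f := fun j => realCoord H (k, j) ω ^ 2)
            (fun _ _ => sq_nonneg _) (Finset.mem_univ j)
      _ = _ := hH.measure_box k _
      _ ≤ (C * √ε) ^ (2 * N) := pow_le_pow_left₀ measureReal_nonneg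
          (hcC _ (Real.sqrt_pos.2 hε) (Real.sqrt_le_one.2 hε1)).2 _
      _ = C ^ (2 * N) * ε ^ N := by rw [mul_pow, pow_mul √ε, Real.sq_sqrt hε.le]

/-! ### Diversity orders -/

/-- A function of the exact order `P ^ (-D)` has diversity order `D`. -/
lemma hasDiversityOrder_of_bounds {f : ℝ → ℝ} {D : ℕ} {c C : ℝ} (hc : 0 < c)
    (hlow : ∀ᶠ P in atTop, c * P⁻¹ ^ D ≤ f P) (hup : ∀ᶠ P in atTop, f P ≤ C * P⁻¹ ^ D) :
    HasDiversityOrder f D := by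
  have hlim : ∀ a : ℝ, Tendsto (fun P : ℝ => (D : ℝ) - a / Real.log P) atTop (nhds D) := by
    intro a
    simpa using tendsto_const_nhds.sub
      ((tendsto_const_nhds (x := a)).div_atTop Real.tendsto_log_atTop)
  have hlog : ∀ {a P : ℝ}, 0 < a → 1 < P →
      -(Real.log (a * P⁻¹ ^ D) / Real.log P) = D - Real.log a / Real.log P := by
    intro a P ha hP
    have hlP : 0 < Real.log P := Real.log_pos hP
    rw [Real.log_mul ha.ne' (by positivity), Real.log_pow, Real.log_inv]
    field_simp
    ring
  refine tendsto_of_tendsto_of_tendsto_of_le_of_le' (hlim (Real.log C)) (hlim (Real.log c)) ?_ ?_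
  · filter_upwards [hlow, hup, eventually_gt_atTop 1] with P h1 h2 hP
    have hlP : 0 < Real.log P := Real.log_pos hP
    have hf : 0 < f P := lt_of_lt_of_le (by positivity) h1
    have hC : 0 < C := pos_of_mul_pos_left (hf.trans_le h2) (by positivity)
    rw [← hlog hC hP]
    gcongr
  · filter_upwards [hlow, eventually_gt_atTop 1] with P h1 hP
    have hlP : 0 < Real.log P := Real.log_pos hP
    rw [← hlog hc hP]
    gcongr

/-- Single-user beamforming is in outage exactly when the channel gain is below
`(2 ^ R - 1) / P`. -/
lemma logb_one_add_lt_iff {x R P : ℝ} (hx : 0 ≤ x) (hP : 0 < P) :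
    Real.logb 2 (1 + x * P) < R ↔ x < (2 ^ R - 1) * P⁻¹ := by
  rw [Real.logb_lt_iff_lt_rpow (by norm_num) (by positivity), ← div_eq_mul_inv, lt_div_iff₀ hP,
    lt_sub_iff_add_lt']

lemma exists_scaled_ball_bounds [IsProbabilityMeasure μ] (hN : 1 ≤ N)
    (hH : IsRayleighFading μ H) {a : ℝ} (ha : 0 < a) :
    ∃ c > 0, ∃ C > 0, ∀ᶠ P in atTop, ∀ k : Fin K,
      c * P⁻¹ ^ N ≤ μ.real {ω | ‖H ω k‖ ^ 2 < a * P⁻¹} ∧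
        μ.real {ω | ‖H ω k‖ ^ 2 < a * P⁻¹} ≤ C * P⁻¹ ^ N := by
  obtain ⟨c, hc, C, hC, h⟩ := hH.exists_ball_bounds hN
  refine ⟨c * a ^ N, by positivity, C * a ^ N, by positivity, ?_⟩
  filter_upwards [eventually_gt_atTop 0, eventually_ge_atTop a] with P hP hPa k
  have := h k (a * P⁻¹) (by positivity) (by rwa [← div_eq_mul_inv, div_le_one hP])
  rwa [mul_pow, ← mul_assoc, ← mul_assoc] at this

lemma exists_mrtOutage_bounds [IsProbabilityMeasure μ] (hN : 1 ≤ N)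
    (hH : IsRayleighFading μ H) {R : ℝ} (hR : 0 < R) :
    ∃ c > 0, ∃ C > 0, ∀ᶠ P in atTop, ∀ k : Fin K,
      c * P⁻¹ ^ N ≤ mrtOutage μ H k R P ∧ mrtOutage μ H k R P ≤ C * P⁻¹ ^ N := by
  obtain ⟨c, hc, C, hC, h⟩ :=
    exists_scaled_ball_bounds hN hH (sub_pos.2 (one_lt_two_rpow hR))
  refine ⟨c, hc, C, hC, ?_⟩
  filter_upwards [h, eventually_gt_atTop 0] with P h hP k
  simpa only [mrtOutage, logb_one_add_lt_iff (sq_nonneg _) hP] using h k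

/-- The events compared here need not be measurable, as the transmission may depend on the channel
in any way; monotonicity and subadditivity of the outer measure are enough. -/
lemma exists_outage_bounds [IsProbabilityMeasure μ] (hN : 1 ≤ N) (hH : IsRayleighFading μ H)
    {θ : ℝ} (hθ0 : 0 ≤ θ) (hθ1 : θ < 1) {R : ℝ} (hR : 0 < R) {δ : Finset (Fin K) → ℕ → ℝ}
    (hδ : IsPowerDistribution R δ) {T : Channel N K → Transmission N K}
    (hT : ∀ h, (T h).IsMixture θ h) :
    ∃ c > 0, ∃ C > 0, ∀ᶠ P in atTop,
      (∀ k, c * P⁻¹ ^ N ≤ μ.real {ω | (T (H ω)).rate δ (H ω) P k < R}) ∧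
        overallOutage μ H T δ R P ≤ C * P⁻¹ ^ N := by
  obtain ⟨a, ha, hrate⟩ := exists_le_rate (N := N) hθ0 hθ1 hR hδ
  obtain ⟨c, hc, _, _, hlow⟩ := exists_mrtOutage_bounds hN hH hR
  obtain ⟨_, _, C, hC, hup⟩ := exists_scaled_ball_bounds hN hH ha
  refine ⟨c, hc, K * C + 1, by positivity, ?_⟩
  filter_upwards [hlow, hup, eventually_gt_atTop 0] with P hlow hup hP
  refine ⟨fun k => (hlow k).1.trans (measureReal_mono fun ω hω => ?_), ?_⟩
  · exact ((hT (H ω)).rate_le hθ0 hθ1 hδ hP.le k).trans_lt hω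
  · calc overallOutage μ H T δ R P
        ≤ μ.real (⋃ k : Fin K, {ω | ‖H ω k‖ ^ 2 < a * P⁻¹}) := by
          refine measureReal_mono fun ω ⟨k, hk⟩ => ?_
          by_contra hω
          simp only [Set.mem_iUnion, Set.mem_ofPred_eq, not_exists, not_lt,
            ← div_eq_mul_inv, div_le_iff₀ hP] at hω
          exact absurd (hrate _ _ (hT (H ω)) P hP hω k) (not_le.2 hk)
      _ ≤ ∑ k : Fin K, μ.real {ω | ‖H ω k‖ ^ 2 < a * P⁻¹} := measureReal_iUnion_fintype_le _
      _ ≤ ∑ _k : Fin K, C * P⁻¹ ^ N := Finset.sum_le_sum fun k _ => (hup k).2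
      _ = K * C * P⁻¹ ^ N := by simp [mul_assoc]
      _ ≤ (K * C + 1) * P⁻¹ ^ N := by gcongr; linarith

end MixtureBC

theorem corollary1 (N K : ℕ) (hK : 1 ≤ K) (hKN : K ≤ N)
    (θth : ℝ) (hθ0 : 0 < θth) (hθ1 : θth < 1) (R : ℝ) (hR : 0 < R)
    {Ω : Type*} [MeasurableSpace Ω] (μ : MeasureTheory.Measure Ω)
    [MeasureTheory.IsProbabilityMeasure μ]
    (H : Ω → MixtureBC.Channel N K) (hH : MixtureBC.IsRayleighFading μ H) :
    (∃ δ : Finset (Fin K) → ℕ → ℝ, MixtureBC.IsPowerDistribution R δ) ∧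
    (∃ T : MixtureBC.Channel N K → MixtureBC.Transmission N K,
      ∀ h, (T h).IsMixture θth h) ∧
    (∀ (δ : Finset (Fin K) → ℕ → ℝ)
      (T : MixtureBC.Channel N K → MixtureBC.Transmission N K),
      MixtureBC.IsPowerDistribution R δ → (∀ h, (T h).IsMixture θth h) →
        MixtureBC.HasDiversityOrder (MixtureBC.overallOutage μ H T δ R) N ∧
        MixtureBC.HasDiversityOrder (MixtureBC.outageFrequency μ H T δ R) N) ∧
    (∀ k, MixtureBC.HasDiversityOrder (MixtureBC.mrtOutage μ H k R) N) := by
  have hN : 1 ≤ N := hK.trans hKN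
  have hK' : (0 : ℝ) < K := by exact_mod_cast hK
  refine ⟨MixtureBC.exists_isPowerDistribution hR, ?_, fun δ T hδ hT => ?_, fun k => ?_⟩
  · choose T hT using fun h : MixtureBC.Channel N K =>
      MixtureBC.exists_isMixture hθ0.le hθ1 h
    exact ⟨T, hT⟩
  · obtain ⟨c, hc, C, -, hb⟩ := MixtureBC.exists_outage_bounds hN hH hθ0.le hθ1 hR hδ hT
    have hsub : ∀ P k, μ.real {ω | (T (H ω)).rate δ (H ω) P k < R} ≤
        MixtureBC.overallOutage μ H T δ R P := fun P k =>
      MeasureTheory.measureReal_mono fun ω hω => ⟨k, hω⟩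
    refine ⟨MixtureBC.hasDiversityOrder_of_bounds hc ?_ (hb.mono fun P h => h.2),
      MixtureBC.hasDiversityOrder_of_bounds hc ?_ (C := C) ?_⟩
    · exact hb.mono fun P h => (h.1 ⟨0, hK⟩).trans (hsub P _)
    · refine hb.mono fun P h => ?_
      rw [MixtureBC.outageFrequency, le_div_iff₀ hK']
      have := Finset.card_nsmul_le_sum Finset.univ _ _ fun k _ => h.1 k
      simpa [mul_comm] using this
    · refine hb.mono fun P h => le_trans ?_ h.2
      rw [MixtureBC.outageFrequency, div_le_iff₀ hK']
      have := Finset.sum_le_card_nsmul Finset.univ _ _ fun k _ => hsub P k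
      simpa [mul_comm] using this
  · obtain ⟨c, hc, C, -, hb⟩ := MixtureBC.exists_mrtOutage_bounds hN hH hR
    exact MixtureBC.hasDiversityOrder_of_bounds hc (hb.mono fun P h => (h k).1)
      (hb.mono fun P h => (h k).2)
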